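/- **Setting.** A job set $\mathcal J$ consists of $n\ge 0$ jobs with real sizes $p_1,\dots,p_n\ge 0$, to be scheduled on $m\ge 1$ parallel identical machines. The makespan of a schedule is the maximum load of a machine, the load being the sum of the sizes of the jobs on it, and $\mathrm{OPT}(\mathcal J)$ is the minimum makespan of all schedules. For a permutation $\sigma\in S_n$, $\mathcal J^\sigma$ is the sequence $J_{\sigma(1)},\dots,J_{\sigma(n)}$ and $A(\mathcal J^\sigma)$ the makespan of algorithm $A$ on it. Under $\sigma\sim S_n$ each permutation has probability $1/n!$. A deterministic algorithm is *online* if the machine given to a job depends only on $m$, on the number $n$ of jobs, and on the sizes of the jobs that arrived up to and including that job. A deterministic online algorithm $A$ is *nearly $c$-competitive* if 1. there is a constant $C\ge 1$ with $A(\mathcal J^\sigma)\le C\,\mathrm{OPT}(\mathcal J)$ for all $m\geq 1$, all $\mathcal J$ and all $\sigma$; and 2. for every $\varepsilon>0$ there is $m(\varepsilon)$ such that, for all $m\ge m(\varepsilon)$ and all job sets $\mathcal J$ with at least one job of positive size, $\mathbf P_{\sigma\sim S_n}\big[A(\mathcal J^\sigma)\ge (c+\varepsilon)\,\mathrm{OPT}(\mathcal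 J)\big]\le\varepsilon$. It is *$c$-competitive in the secretary model for $m\to\infty$* if for every $\varepsilon>0$ there is $m(\varepsilon)$ such that, for all $m\ge m(\varepsilon)$ and all job sets $\mathcal J$, $\frac1{n!}\sum_{\sigma\in S_n}A(\mathcal J^\sigma)\le (c+\varepsilon)\,\mathrm{OPT}(\mathcal J)$. **The algorithm.** Given a number $G$, $\mathrm{LightLoad}[G]$ processes the jobs in order of arrival. When a job of size $x$ arrives, let $l_{\mathrm{low}}$ be the smallest current load of a machine, let $M_{\mathrm{mid}}$ be a machine with the $\lfloor m/2\rfloor$-lowest current load (for $m=1$, the only machine) and let $l_{\mathrm{mid}}$ be its load. If $l_{\mathrm{low}}\le 0.25\,G$ or $l_{\mathrm{mid}}+x>1.75\,G$, the job is put on a least loaded machine; otherwise it is put on $M_{\mathrm{mid}}$. Ties are broken by an arbitrary fixed deterministic rule, which may depend on the current loads. Let $L_{1/4}[\mathcal J^\sigma]=\frac{4}{m}\sum_{t\le n/4}p_{\sigma(t)}$ and $\delta=\delta(m)=1/\log m$ (for $m=1$, where every algorithm produces the same schedule, put $\delta=0$). $\mathrm{LightLoadROM}$ is $\mathrm{LightLoad}[G]$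 run on $\mathcal J^\sigma$ with the guess $G=\frac{L_{1/4}[\mathcal J^\sigma]}{1-\delta}$ for the average load. **Theorem.** For every tie-breaking rule, $\mathrm{LightLoadROM}$ is a deterministic online algorithm, it is nearly $1.75$-competitive, and it is $1.75$-competitive in the secretary model for $m\to\infty$. -/

import Mathlib

open scoped BigOperators

noncomputable section

namespace Scheduling

/-! ### Makespan minimization on `m` identical machines

A job set is a family `p : Fin n → ℝ` of non-negative sizes. The same type serves for ordered
sequences: `p t` is then the size of the job arriving at (zero-based) time `t`. An order
`σ : Equiv.Perm (Fin n)` turns the job set `p` into the sequence `p ∘ σ`. A schedule is a map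
`Fin n → Fin m` from jobs to machines. -/

/-- The maximum load of a machine in the schedule `a` of the jobs `p`. -/
def makespan {m n : ℕ} (p : Fin n → ℝ) (a : Fin n → Fin m) : ℝ :=
  ⨆ j : Fin m, ∑ i ∈ Finset.univ.filter (fun i => a i = j), p i

/-- The optimum makespan of the job set `p` on `m` machines. -/
def opt (m : ℕ) {n : ℕ} (p : Fin n → ℝ) : ℝ :=
  ⨅ a : Fin n → Fin m, makespan p a

/-- A deterministic algorithm: for every number `m ≥ 1` of machines, every number `n` of jobs and
every input sequence it outputs a schedule. -/
abbrev Algorithm : Type :=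
  ∀ (m : ℕ) [NeZero m] (n : ℕ), (Fin n → ℝ) → (Fin n → Fin m)

/-- The makespan of algorithm `A` on the input sequence `p`. -/
def Algorithm.cost (A : Algorithm) (m : ℕ) [NeZero m] {n : ℕ} (p : Fin n → ℝ) : ℝ :=
  makespan p (A m n p)

/-- `A` is an online algorithm (knowing the number `n` of jobs): the machine that receives
a job depends only on the sizes of the jobs that arrived up to and including that job. -/
def Algorithm.IsOnline (A : Algorithm) : Prop :=
  ∀ (m : ℕ) [NeZero m] (n : ℕ) (p q : Fin n → ℝ), (∀ i, 0 ≤ p i) → (∀ i, 0 ≤ q i) →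
    ∀ t : Fin n, (∀ s ≤ t, p s = q s) → A m n p t = A m n q t

/-- `A` achieves a constant competitive ratio in the adversarial model. -/
def Algorithm.ConstantCompetitive (A : Algorithm) : Prop :=
  ∃ C : ℝ, 1 ≤ C ∧ ∀ (m : ℕ) [NeZero m] (n : ℕ) (p : Fin n → ℝ), (∀ i, 0 ≤ p i) →
    ∀ σ : Equiv.Perm (Fin n), A.cost m (p ∘ σ) ≤ C * opt m p

open Classical in
/-- Probability of the event `E` for a uniformly random order of `n` jobs. -/
def orderProb {n : ℕ} (E : Equiv.Perm (Fin n) → Prop) : ℝ :=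
  ((Finset.univ.filter E).card : ℝ) / (n.factorial : ℝ)

/-- The expected makespan of `A` on the job set `p` under a uniformly random order. -/
def Algorithm.romCost (A : Algorithm) (m : ℕ) [NeZero m] {n : ℕ} (p : Fin n → ℝ) : ℝ :=
  (1 / (n.factorial : ℝ)) * ∑ σ : Equiv.Perm (Fin n), A.cost m (p ∘ σ)

/-- `A` is nearly `c`-competitive. Job sets all of whose jobs have size zero are excluded in the
second condition, since both sides of the inequality vanish for them. -/
def Algorithm.NearlyCompetitive (A : Algorithm) (c : ℝ) : Prop :=
  A.ConstantCompetitive ∧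
  ∀ ε : ℝ, 0 < ε → ∃ m₀ : ℕ, ∀ (m : ℕ) [NeZero m], m₀ ≤ m →
    ∀ (n : ℕ) (p : Fin n → ℝ), (∀ i, 0 ≤ p i) → (∃ i, 0 < p i) →
      orderProb (fun σ : Equiv.Perm (Fin n) => A.cost m (p ∘ σ) ≥ (c + ε) * opt m p) ≤ ε

/-- `A` is `c`-competitive in the secretary model as the number `m` of machines tends to infinity:
for every `ε > 0` it is `(c + ε)`-competitive in the secretary model for all large `m`. -/
def Algorithm.SecretaryCompetitive (A : Algorithm) (c : ℝ) : Prop :=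
  ∀ ε : ℝ, 0 < ε → ∃ m₀ : ℕ, ∀ (m : ℕ) [NeZero m], m₀ ≤ m →
    ∀ (n : ℕ) (p : Fin n → ℝ), (∀ i, 0 ≤ p i) → A.romCost m p ≤ (c + ε) * opt m p

/-! ### The algorithm LightLoad -/

/-- The machines having the `k`-th lowest load, for the load vector `l`. -/
def kthLowest {m : ℕ} (l : Fin m → ℝ) (k : ℕ) : Finset (Fin m) :=
  Finset.univ.filter fun j =>
    (Finset.univ.filter fun i => l i < l j).card < k ∧
      k ≤ (Finset.univ.filter fun i => l i ≤ l j).card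

/-- The least loaded machines. -/
def leastLoaded {m : ℕ} (l : Fin m → ℝ) : Finset (Fin m) :=
  Finset.univ.filter fun j => ∀ i, l j ≤ l i

/-- A deterministic rule for breaking ties: given the current loads, it selects a machine from any
nonempty set of machines. -/
structure TieBreak where
  pick : ∀ (m : ℕ) [NeZero m], (Fin m → ℝ) → Finset (Fin m) → Fin m
  pick_mem : ∀ (m : ℕ) [NeZero m] (l : Fin m → ℝ) (S : Finset (Fin m)),
    S.Nonempty → pick m l S ∈ S

variable (τ : TieBreak) {m : ℕ} [NeZero m]

/-- The least loaded machine used by the algorithm. -/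
def lowMachine (l : Fin m → ℝ) : Fin m := τ.pick m l (leastLoaded l)

/-- The machine `M_mid` with the `⌊m/2⌋`-lowest load (for `m = 1`, the only machine). -/
def midMachine (l : Fin m → ℝ) : Fin m := τ.pick m l (kthLowest l (max 1 (m / 2)))

/-- The machine on which LightLoad with parameter `G` (the guess for the average load) puts a job
of size `x` when the current loads are `l`. -/
def lightLoadStep (G : ℝ) (l : Fin m → ℝ) (x : ℝ) : Fin m :=
  if l (lowMachine τ l) ≤ 0.25 * G ∨ l (midMachine τ l) + x > 1.75 * G then
    lowMachine τ l
  else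
    midMachine τ l

/-- The loads after LightLoad with parameter `G` has scheduled the first `t` jobs of `p`. -/
def lightLoadLoads (G : ℝ) {n : ℕ} (p : Fin n → ℝ) : ℕ → Fin m → ℝ
  | 0 => fun _ => 0
  | t + 1 =>
    if h : t < n then
      let l := lightLoadLoads G p t
      let j := lightLoadStep τ G l (p ⟨t, h⟩)
      Function.update l j (l j + p ⟨t, h⟩)
    else lightLoadLoads G p t

/-- The schedule of LightLoad with parameter `G` on the input sequence `p`. -/
def lightLoad (m : ℕ) [NeZero m] (G : ℝ) {n : ℕ} (p : Fin n → ℝ) (t : Fin n) : Fin m :=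
  lightLoadStep τ G (lightLoadLoads τ G p t) (p t)

/-- The load estimate `L_φ = (1 / (φ m)) ∑ p_t`, the sum ranging over the first `φ n` jobs. -/
def loadEstimate (m : ℕ) {n : ℕ} (φ : ℝ) (p : Fin n → ℝ) : ℝ :=
  1 / (φ * m) * ∑ t ∈ Finset.univ.filter (fun t : Fin n => ((t : ℕ) : ℝ) + 1 ≤ φ * n), p t

/-- The margin of error `δ(m) = 1 / log m`. -/
def margin (m : ℕ) : ℝ := 1 / Real.log m

/-- The guess `L_{1/4} / (1 - δ)` for the average load. -/
def guessPre (m : ℕ) {n : ℕ} (p : Fin n → ℝ) : ℝ :=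
  loadEstimate m (1 / 4) p / (1 - margin m)

/-- LightLoadROM: LightLoad run with the guess `L_{1/4} / (1 - δ)`. -/
def lightLoadROM : Algorithm := fun m _ _ p => lightLoad τ m (guessPre m p) p

end Scheduling

end

open scoped BigOperators

noncomputable section

namespace Scheduling

/-! ### Schedules and the optimum -/

section Optimum

variable {m n : ℕ}

/-! The proof separates a deterministic statement from a concentration statement.

Deterministic part (`makespan_lightLoad_le_mul_max`): let `G` be at least the average load and `B =
max G OPT`. A job put on the middle machine never pushes it above `1.75 G`. If a job `T` put on a
least loaded machine exceeds `1.75 B`, then both `T` and the minimum load `v` before it exceed `0.75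
B` (`Critical`). A volume argument shows that, once the minimum load has passed `0.25 G`, fewer than
half of the machines are below `v`, so the middle machine is already at `v` or higher
(`Critical.card_below_lt`). Hence a machine that receives only jobs of size at most `B / 2` cannot
climb to `v` (`Critical.load_le_of_small`). So every machine holds a job larger than `B / 2`; with
`T` these are `m + 1` such jobs, and two of them share a machine in an optimal schedule, whence `OPT
> B`, a contradiction.

Random part: if `OPT` is at least five times the average load, a greedy bound settles every order.
Otherwise no job is large compared with the total size, and Chebyshev's inequality for sampling
without replacement (`orderProb_deviation_le`) puts the estimate within a factor `1 ± δ` of the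
average load with high probability. Dividing by `1 - δ` makes the guess an upper bound on the
average at the cost of a factor tending to `1`. Constant competitiveness controls the remaining
orders in expectation.

The algorithm is online although its guess looks ahead: during the sampling phase it uses a least
loaded machine whatever the guess is. -/

lemma load_le_makespan (p : Fin n → ℝ) (a : Fin n → Fin m) (j : Fin m) :
    ∑ i ∈ Finset.univ.filter (fun i => a i = j), p i ≤ makespan p a :=
  le_ciSup (f := fun j : Fin m => ∑ i ∈ Finset.univ.filter (fun i => a i = j), p i)
    (Set.finite_range _).bddAbove j

lemma makespan_le [NeZero m] {p : Fin n → ℝ} {a : Fin n → Fin m} {K : ℝ}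
    (h : ∀ j, ∑ i ∈ Finset.univ.filter (fun i => a i = j), p i ≤ K) : makespan p a ≤ K :=
  ciSup_le h

lemma exists_makespan_eq_opt [NeZero m] (p : Fin n → ℝ) :
    ∃ a : Fin n → Fin m, makespan p a = opt m p :=
  exists_eq_ciInf_of_finite

lemma makespan_comp_perm (p : Fin n → ℝ) (a : Fin n → Fin m) (σ : Equiv.Perm (Fin n)) :
    makespan (p ∘ σ) (a ∘ σ) = makespan p a := by
  unfold makespan
  congr 1
  ext j
  exact Finset.sum_equiv σ (by simp) (by simp)

lemma opt_comp_perm (p : Fin n → ℝ) (σ : Equiv.Perm (Fin n)) :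
    opt m (p ∘ σ) = opt m p := by
  unfold opt
  refine (Equiv.iInf_congr (σ.arrowCongr (Equiv.refl (Fin m))).symm fun a => ?_).symm
  exact makespan_comp_perm p a σ

lemma le_opt [NeZero m] {p : Fin n → ℝ} (hp : ∀ i, 0 ≤ p i) (i : Fin n) : p i ≤ opt m p := by
  obtain ⟨a, ha⟩ := exists_makespan_eq_opt (m := m) p
  rw [← ha]
  refine le_trans ?_ (load_le_makespan p a (a i))
  exact Finset.single_le_sum (fun i _ => hp i) (by simp)

lemma sum_le_mul_opt [NeZero m] (p : Fin n → ℝ) : ∑ i, p i ≤ m * opt m p := by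
  obtain ⟨a, ha⟩ := exists_makespan_eq_opt (m := m) p
  rw [← ha, ← Finset.sum_fiberwise Finset.univ a p]
  refine (Finset.sum_le_sum fun j _ => load_le_makespan p a j).trans ?_
  simp

lemma opt_nonneg [NeZero m] {p : Fin n → ℝ} (hp : ∀ i, 0 ≤ p i) : 0 ≤ opt m p := by
  have hm : (0 : ℝ) < m := by exact_mod_cast NeZero.pos m
  have := (Finset.sum_nonneg fun i _ => hp i).trans (sum_le_mul_opt (m := m) p)
  exact nonneg_of_mul_nonneg_right this hm

/-- At most `m` jobs are larger than half of the optimum. -/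
lemma card_filter_opt_lt_le [NeZero m] {p : Fin n → ℝ} (hp : ∀ i, 0 ≤ p i) :
    (Finset.univ.filter fun i => opt m p < 2 * p i).card ≤ m := by
  obtain ⟨a, ha⟩ := exists_makespan_eq_opt (m := m) p
  have hinj : Set.InjOn a (Finset.univ.filter fun i => opt m p < 2 * p i : Finset (Fin n)) := by
    intro i hi j hj hij
    by_contra hne
    simp only [Finset.coe_filter, Finset.mem_univ, true_and, Set.mem_ofPred_eq] at hi hj
    have h1 := load_le_makespan p a (a i)
    have h2 : ∑ s ∈ ({i, j} : Finset (Fin n)), p s ≤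
        ∑ s ∈ Finset.univ.filter (fun s => a s = a i), p s := by
      refine Finset.sum_le_sum_of_subset_of_nonneg ?_ fun s _ _ => hp s
      intro s hs
      rcases Finset.mem_insert.1 hs with rfl | hs
      · simp
      · rw [Finset.mem_singleton.1 hs]; simp [hij]
    rw [Finset.sum_pair hne] at h2
    linarith
  have := Finset.card_le_card_of_injOn a (t := Finset.univ) (fun _ _ => Finset.mem_univ _) hinj
  simpa using this

end Optimum

/-! ### The machines selected by LightLoad -/

section Machines

variable (τ : TieBreak) {m : ℕ} [NeZero m]

lemma lowMachine_le (l : Fin m → ℝ) (i : Fin m) : l (lowMachine τ l) ≤ l i := by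
  have hne : (leastLoaded l).Nonempty := by
    obtain ⟨j, -, hj⟩ := Finset.exists_min_image Finset.univ l Finset.univ_nonempty
    exact ⟨j, by simpa [leastLoaded] using hj⟩
  have := τ.pick_mem m l _ hne
  simp only [leastLoaded, Finset.mem_filter, Finset.mem_univ, true_and] at this
  exact this i

lemma card_mul_lowMachine_le (l : Fin m → ℝ) : m * l (lowMachine τ l) ≤ ∑ i, l i := by
  have := Finset.card_nsmul_le_sum Finset.univ l _ fun i _ => lowMachine_le τ l i
  simpa using this

lemma kthLowest_nonempty (l : Fin m → ℝ) {k : ℕ} (hk : 1 ≤ k) (hkm : k ≤ m) :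
    (kthLowest l k).Nonempty := by
  set S := Finset.univ.filter fun j => k ≤ (Finset.univ.filter fun i => l i ≤ l j).card with hS
  have hSne : S.Nonempty := by
    obtain ⟨j, -, hj⟩ := Finset.exists_max_image Finset.univ l Finset.univ_nonempty
    refine ⟨j, ?_⟩
    simp only [hS, Finset.mem_filter, Finset.mem_univ, true_and]
    rw [Finset.filter_true_of_mem fun i _ => hj i (Finset.mem_univ _)]
    simpa using hkm
  obtain ⟨j, hjS, hj⟩ := Finset.exists_min_image S l hSne
  refine ⟨j, ?_⟩
  simp only [kthLowest, Finset.mem_filter, Finset.mem_univ, true_and]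
  refine ⟨?_, by simpa [hS] using hjS⟩
  -- If `k` machines lay strictly below `j`, the highest of them would be a lower member of `S`.
  by_contra! hlt
  have hne : (Finset.univ.filter fun i => l i < l j).Nonempty :=
    Finset.card_pos.1 (by omega)
  obtain ⟨i, hi, hmax⟩ := Finset.exists_max_image _ l hne
  have hi' : l i < l j := by simpa using hi
  refine absurd (hj i ?_) (not_le.2 hi')
  simp only [hS, Finset.mem_filter, Finset.mem_univ, true_and]
  refine hlt.trans (Finset.card_le_card fun s hs => ?_)
  simpa using hmax s hs

lemma midMachine_mem (l : Fin m → ℝ) : midMachine τ l ∈ kthLowest l (max 1 (m / 2)) :=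
  τ.pick_mem m l _ (kthLowest_nonempty l (le_max_left _ _)
    (max_le (NeZero.pos m) (Nat.div_le_self _ _)))

lemma card_lt_midMachine (l : Fin m → ℝ) :
    (Finset.univ.filter fun i => l i < l (midMachine τ l)).card < max 1 (m / 2) := by
  have := midMachine_mem τ l
  simp only [kthLowest, Finset.mem_filter, Finset.mem_univ, true_and] at this
  exact this.1

lemma le_card_le_midMachine (l : Fin m → ℝ) :
    max 1 (m / 2) ≤ (Finset.univ.filter fun i => l i ≤ l (midMachine τ l)).card := by
  have := midMachine_mem τ l
  simp only [kthLowest, Finset.mem_filter, Finset.mem_univ, true_and] at this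
  exact this.2

lemma card_midMachine_le (l : Fin m → ℝ) :
    m + 1 ≤ (Finset.univ.filter fun i => l (midMachine τ l) ≤ l i).card + max 1 (m / 2) := by
  have h := card_lt_midMachine τ l
  have h2 := Finset.card_filter_add_card_filter_not (s := (Finset.univ : Finset (Fin m)))
    (fun i => l i < l (midMachine τ l))
  simp only [not_lt, Finset.card_univ, Fintype.card_fin] at h2
  omega

end Machines

/-! ### The loads produced by LightLoad -/

section Loads

variable (τ : TieBreak) {m : ℕ} [NeZero m] (G : ℝ) {n : ℕ} (p : Fin n → ℝ)

lemma lightLoadLoads_succ (t : Fin n) :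
    lightLoadLoads τ G p (t + 1) =
      Function.update (lightLoadLoads τ G p t) (lightLoad τ m G p t)
        (lightLoadLoads τ G p t (lightLoad τ m G p t) + p t) := by
  simp [lightLoadLoads, lightLoad]

lemma lightLoadLoads_succ_apply (t : Fin n) (j : Fin m) :
    lightLoadLoads τ G p (t + 1) j =
      lightLoadLoads τ G p t j + if lightLoad τ m G p t = j then p t else 0 := by
  rw [lightLoadLoads_succ]
  by_cases h : lightLoad τ m G p t = j
  · subst h; simp
  · simp [h, Function.update_of_ne (Ne.symm h)]

lemma lightLoadLoads_succ_of_le {t : ℕ} (h : n ≤ t) :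
    lightLoadLoads (m := m) τ G p (t + 1) = lightLoadLoads τ G p t := by
  simp [lightLoadLoads, not_lt.2 h]

lemma lightLoadLoads_eq_sum (t : ℕ) (j : Fin m) :
    lightLoadLoads τ G p t j =
      ∑ i ∈ Finset.univ.filter (fun i : Fin n => (i : ℕ) < t ∧ lightLoad τ m G p i = j), p i := by
  induction t with
  | zero => simp [lightLoadLoads]
  | succ t ih =>
    by_cases h : t < n
    · have hs := lightLoadLoads_succ_apply τ G p ⟨t, h⟩ j
      rw [show lightLoadLoads τ G p (t + 1) j = _ from hs]
      simp only
      rw [ih]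
      simp only [Finset.sum_filter]
      rw [← Finset.sum_erase_add _ _ (Finset.mem_univ (⟨t, h⟩ : Fin n)),
        ← Finset.sum_erase_add (Finset.univ : Finset (Fin n)) _ (Finset.mem_univ (⟨t, h⟩ : Fin n))]
      simp only [lt_irrefl, false_and, if_false, add_zero, lt_add_one, true_and]
      congr 1
      refine Finset.sum_congr rfl fun i hi => ?_
      have : (i : ℕ) ≠ t := fun h' => (Finset.mem_erase.1 hi).1 (Fin.ext h')
      have h1 : (i : ℕ) < t ↔ (i : ℕ) < t + 1 := by omega
      simp only [h1]
    · rw [lightLoadLoads_succ_of_le τ G p (not_lt.1 h), ih]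
      refine Finset.sum_congr (Finset.filter_congr fun i _ => ?_) fun _ _ => rfl
      have := i.2
      have h1 : (i : ℕ) < t ↔ (i : ℕ) < t + 1 := by omega
      rw [h1]

lemma sum_lightLoad_eq_lightLoadLoads (j : Fin m) :
    ∑ i ∈ Finset.univ.filter (fun i => lightLoad τ m G p i = j), p i =
      lightLoadLoads τ G p n j := by
  rw [lightLoadLoads_eq_sum]
  simp

lemma sum_lightLoadLoads (t : ℕ) :
    ∑ j : Fin m, lightLoadLoads τ G p t j =
      ∑ i ∈ Finset.univ.filter (fun i : Fin n => (i : ℕ) < t), p i := by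
  rw [← Finset.sum_fiberwise _ (lightLoad τ m G p) p]
  refine Finset.sum_congr rfl fun j _ => ?_
  rw [lightLoadLoads_eq_sum, Finset.filter_filter]

variable {p}

lemma lightLoadLoads_mono (hp : ∀ i, 0 ≤ p i) {s t : ℕ} (hst : s ≤ t) (j : Fin m) :
    lightLoadLoads τ G p s j ≤ lightLoadLoads τ G p t j := by
  rw [lightLoadLoads_eq_sum, lightLoadLoads_eq_sum]
  refine Finset.sum_le_sum_of_subset_of_nonneg (fun i hi => ?_) fun i _ _ => hp i
  simp only [Finset.mem_filter, Finset.mem_univ, true_and] at hi ⊢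
  exact ⟨by omega, hi.2⟩

lemma lightLoadLoads_nonneg (hp : ∀ i, 0 ≤ p i) (t : ℕ) (j : Fin m) :
    0 ≤ lightLoadLoads τ G p t j :=
  lightLoadLoads_mono τ G hp (Nat.zero_le t) j

lemma sum_lightLoadLoads_add_le (hp : ∀ i, 0 ≤ p i) (t : Fin n) :
    ∑ j : Fin m, lightLoadLoads τ G p t j + p t ≤ ∑ i, p i := by
  rw [sum_lightLoadLoads, ← Finset.sum_filter_add_sum_filter_not Finset.univ
    (fun i : Fin n => (i : ℕ) < t) p]
  gcongr
  exact Finset.single_le_sum (fun i _ => hp i) (by simp)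

/-- The load of the machine that receives a job is at most `K` afterwards, provided that
`K` dominates `1.75 G` and the average load plus the size of any job. -/
lemma makespan_lightLoad_le {K : ℝ} (hK : 0 ≤ K)
    (hstep : ∀ t : Fin n, lightLoad τ m G p t = lowMachine (m := m) τ (lightLoadLoads τ G p t) →
      lightLoadLoads τ G p t (lowMachine (m := m) τ (lightLoadLoads τ G p t)) + p t ≤ K)
    (hG : 1.75 * G ≤ K) : makespan p (lightLoad τ m G p) ≤ K := by
  refine makespan_le fun j => ?_
  rw [sum_lightLoad_eq_lightLoadLoads]
  suffices ∀ t ≤ n, lightLoadLoads τ G p t j ≤ K from this n le_rfl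
  intro t
  induction t with
  | zero => intro _; simpa [lightLoadLoads] using hK
  | succ t ih =>
    intro ht
    have hs := lightLoadLoads_succ_apply τ G p ⟨t, ht⟩ j
    rw [show lightLoadLoads τ G p (t + 1) j = _ from hs]
    split_ifs with hj
    · by_cases hlow : lightLoad τ m G p ⟨t, ht⟩ = lowMachine τ (lightLoadLoads τ G p t)
      · rw [← hj, hlow]; exact hstep ⟨t, ht⟩ hlow
      · have hmid := hlow
        unfold lightLoad lightLoadStep at hmid
        split_ifs at hmid with hc
        · exact absurd rfl hmid
        · push Not at hc
          have : lightLoad τ m G p ⟨t, ht⟩ = midMachine τ (lightLoadLoads τ G p t) := by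
            unfold lightLoad lightLoadStep
            rw [if_neg (by push Not; exact hc)]
          rw [← hj, this]
          exact hc.2.trans hG
    · simpa using ih (by omega)

/-- A greedy bound that needs no accuracy of the guess: a least loaded machine is at most at the
average. It serves constant competitiveness and the case of a small average load. -/
lemma makespan_lightLoad_le_of_average (hp : ∀ i, 0 ≤ p i) {K : ℝ} (hK : 0 ≤ K)
    (havg : ∀ t, (∑ i, p i) / m + p t ≤ K) (hG : 1.75 * G ≤ K) :
    makespan p (lightLoad τ m G p) ≤ K := by
  refine makespan_lightLoad_le τ G hK (fun t _ => le_trans ?_ (havg t)) hG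
  have hm : (0 : ℝ) < m := by exact_mod_cast NeZero.pos m
  gcongr
  rw [le_div_iff₀' hm]
  have h1 := card_mul_lowMachine_le τ (lightLoadLoads (m := m) τ G p t)
  have h2 := sum_lightLoadLoads_add_le (m := m) τ G hp t
  linarith [hp t]

end Loads
/-! ### LightLoad with a guess not below the average load -/

section Deterministic

variable (τ : TieBreak) {m : ℕ} [NeZero m]

/-- At least half of the machines carry the middle load or more, and the others at least the
minimum. -/
lemma mul_low_add_mid_le (l : Fin m → ℝ) :
    m * (l (lowMachine τ l) + l (midMachine τ l)) ≤ 2 * ∑ i, l i := by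
  set v := l (lowMachine τ l) with hv
  set μ := l (midMachine τ l) with hμ
  have hvμ : v ≤ μ := lowMachine_le τ l _
  have h1 : ∑ i, (v + if μ ≤ l i then μ - v else 0) ≤ ∑ i, l i := by
    refine Finset.sum_le_sum fun i _ => ?_
    have := lowMachine_le τ l i
    split_ifs with h <;> linarith
  rw [Finset.sum_add_distrib, ← Finset.sum_filter] at h1
  simp only [Finset.sum_const, Finset.card_univ, Fintype.card_fin, nsmul_eq_mul] at h1
  have h2 := card_midMachine_le τ l
  rw [← hμ] at h2
  set c := (Finset.univ.filter fun i => μ ≤ l i).card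
  have h3 : m ≤ 2 * c := by omega
  have h4 : (m : ℝ) ≤ 2 * c := by exact_mod_cast h3
  nlinarith [mul_le_mul_of_nonneg_right h4 (sub_nonneg.2 hvμ)]

lemma lowMachine_mono {l l' : Fin m → ℝ} (h : ∀ i, l i ≤ l' i) :
    l (lowMachine τ l) ≤ l' (lowMachine τ l') :=
  (lowMachine_le τ l _).trans (h _)

lemma midMachine_mono {l l' : Fin m → ℝ} (h : ∀ i, l i ≤ l' i) :
    l (midMachine τ l) ≤ l' (midMachine τ l') := by
  by_contra! hlt
  have h1 := card_lt_midMachine τ l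
  have h2 := le_card_le_midMachine τ l'
  have h3 : (Finset.univ.filter fun i => l' i ≤ l' (midMachine τ l')).card ≤
      (Finset.univ.filter fun i => l i < l (midMachine τ l)).card := by
    refine Finset.card_le_card fun i hi => ?_
    simp only [Finset.mem_filter, Finset.mem_univ, true_and] at hi ⊢
    exact ((h i).trans hi).trans_lt hlt
  omega

variable {n : ℕ} {G : ℝ} {p : Fin n → ℝ}

lemma lightLoad_cases (t : Fin n) :
    (lightLoad τ m G p t = lowMachine τ (lightLoadLoads τ G p t) ∧
      lightLoadLoads τ G p t (lowMachine (m := m) τ (lightLoadLoads τ G p t)) ≤ 0.25 * G) ∨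
    (lightLoad τ m G p t = lowMachine τ (lightLoadLoads τ G p t) ∧
      0.25 * G < lightLoadLoads τ G p t (lowMachine (m := m) τ (lightLoadLoads τ G p t)) ∧
      1.75 * G < lightLoadLoads τ G p t (midMachine (m := m) τ (lightLoadLoads τ G p t)) + p t) ∨
    (lightLoad τ m G p t = midMachine τ (lightLoadLoads τ G p t) ∧
      0.25 * G < lightLoadLoads τ G p t (lowMachine (m := m) τ (lightLoadLoads τ G p t))) := by
  unfold lightLoad lightLoadStep
  by_cases h1 : lightLoadLoads τ G p t (lowMachine (m := m) τ (lightLoadLoads τ G p t)) ≤ 0.25 * G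
  · left; simp [h1]
  · right
    rw [not_le] at h1
    by_cases h2 : 1.75 * G <
        lightLoadLoads τ G p t (midMachine (m := m) τ (lightLoadLoads τ G p t)) + p t
    · left; exact ⟨by rw [if_pos (Or.inr h2)], h1, h2⟩
    · right
      refine ⟨?_, h1⟩
      rw [if_neg]
      push Not
      exact ⟨h1, not_lt.1 h2⟩

/-- The machines of load less than `v` after `t` jobs. -/
def below (m : ℕ) [NeZero m] (G : ℝ) (p : Fin n → ℝ) (v : ℝ) (t : ℕ) : Finset (Fin m) :=
  Finset.univ.filter fun j => lightLoadLoads τ G p t j < v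

lemma mem_below {v : ℝ} {t : ℕ} {j : Fin m} :
    j ∈ below τ m G p v t ↔ lightLoadLoads τ G p t j < v := by
  simp [below]

lemma below_anti (hp : ∀ i, 0 ≤ p i) (v : ℝ) {s t : ℕ} (hst : s ≤ t) :
    below τ m G p v t ⊆ below τ m G p v s := fun j hj => by
  rw [mem_below] at hj ⊢
  exact (lightLoadLoads_mono τ G hp hst j).trans_lt hj

lemma mem_below_succ_of_ne {v : ℝ} {t : Fin n} {j : Fin m} (hj : j ∈ below τ m G p v t)
    (hne : lightLoad τ m G p t ≠ j) : j ∈ below τ m G p v (t + 1) := by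
  rw [mem_below] at hj ⊢
  rw [lightLoadLoads_succ_apply, if_neg hne, add_zero]
  exact hj

lemma below_subset_insert (v : ℝ) (t : Fin n) :
    below τ m G p v t ⊆ insert (lightLoad τ m G p t) (below τ m G p v (t + 1)) := fun j hj => by
  by_cases hne : lightLoad τ m G p t = j
  · simp [hne]
  · exact Finset.mem_insert_of_mem (mem_below_succ_of_ne τ hj hne)

lemma le_card_below {v : ℝ} {t : ℕ}
    (h : lightLoadLoads τ G p t (midMachine (m := m) τ (lightLoadLoads τ G p t)) < v) :
    max 1 (m / 2) ≤ (below τ m G p v t).card := by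
  refine (le_card_le_midMachine τ (lightLoadLoads τ G p t)).trans (Finset.card_le_card fun j hj => ?_)
  rw [mem_below]
  simp only [Finset.mem_filter, Finset.mem_univ, true_and] at hj
  exact hj.trans_lt h

/-- If fewer than `⌊m/2⌋` machines have load less than `v` after `t` jobs and `v` is the minimum
load after `T` jobs, then each of these machines has a partner such that the loads of the two sum
up to at least `2 G` on average. -/
lemma exists_partners (hp : ∀ i, 0 ≤ p i) {T : ℕ} (hT : T ≤ n) {v : ℝ}
    (hv : ∀ j, v ≤ lightLoadLoads (m := m) τ G p T j) {A : Finset (Fin m)}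
    (hA : A.card + 1 ≤ max 1 (m / 2)) {t : ℕ} (htT : t ≤ T) (hAt : below τ m G p v t ⊆ A)
    (hlow : 0.25 * G < lightLoadLoads τ G p t (lowMachine (m := m) τ (lightLoadLoads τ G p t))) :
    ∃ P : Finset (Fin m), Disjoint P A ∧ P.card = (below τ m G p v t).card ∧
      2 * G * (below τ m G p v t).card ≤
        ∑ j ∈ below τ m G p v t, lightLoadLoads τ G p T j +
          ∑ j ∈ P, lightLoadLoads τ G p T j := by
  induction htT using Nat.decreasingInduction with
  | self =>
    have hempty : below τ m G p v T = ∅ := by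
      ext j; simp [mem_below, hv j]
    exact ⟨∅, by simp, by simp [hempty], by simp [hempty]⟩
  | of_succ t htT ih =>
    have hmono := fun j => lightLoadLoads_mono (m := m) τ G hp (Nat.le_succ t) j
    have hsub := below_anti (m := m) τ (G := G) hp v (Nat.le_succ t)
    obtain ⟨P, hPA, hPc, hPs⟩ := ih (hsub.trans hAt) (hlow.trans_le (lowMachine_mono τ hmono))
    have htn : t < n := by omega
    have hins := below_subset_insert τ (m := m) (G := G) (p := p) v ⟨t, htn⟩
    have hcases := lightLoad_cases τ (m := m) (G := G) (p := p) ⟨t, htn⟩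
    have hsucc := lightLoadLoads_succ_apply τ (m := m) G p ⟨t, htn⟩
    have hnotin : lightLoad τ m G p ⟨t, htn⟩ ∈ below τ m G p v (t + 1) →
        below τ m G p v (t + 1) = below τ m G p v t := fun h => by
      rw [Finset.insert_eq_of_mem h] at hins
      exact hsub.antisymm hins
    simp only at hins hcases hsucc
    set a := lightLoad τ m G p ⟨t, htn⟩ with ha
    by_cases hat : a ∈ below τ m G p v t
    swap
    · have : below τ m G p v (t + 1) = below τ m G p v t :=
        hsub.antisymm fun j hj => (Finset.mem_insert.1 (hins hj)).resolve_left
          fun h => hat (h ▸ hj)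
      rw [this] at hPc hPs
      exact ⟨P, hPA, hPc, hPs⟩
    by_cases hat' : a ∈ below τ m G p v (t + 1)
    · rw [hnotin hat'] at hPc hPs
      exact ⟨P, hPA, hPc, hPs⟩
    have hcardA := Finset.card_le_card hAt
    -- Otherwise `max 1 (m / 2)` machines would lie below `v`, more than `A` has room for.
    have hmid : v ≤ lightLoadLoads τ G p t (midMachine (m := m) τ (lightLoadLoads τ G p t)) := by
      by_contra! h
      have := le_card_below τ h
      omega
    have heq : below τ m G p v t = insert a (below τ m G p v (t + 1)) :=
      hins.antisymm (Finset.insert_subset hat hsub)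
    have hcard : (below τ m G p v t).card = (below τ m G p v (t + 1)).card + 1 := by
      rw [heq, Finset.card_insert_of_notMem hat']
    -- The job lifting `a` over `v` cannot have gone to the middle machine, so `a` was least loaded
    -- with load above `0.25 G`, and the middle load plus the job exceeded `1.75 G`. These two
    -- bounds add up to `2 G`.
    have hfa : 2 * G < lightLoadLoads τ G p T a +
        lightLoadLoads τ G p t (midMachine (m := m) τ (lightLoadLoads τ G p t)) := by
      have h1 := lightLoadLoads_mono (m := m) τ G hp (show t + 1 ≤ T from htT) a
      have h2 := hsucc a
      rw [if_pos rfl] at h2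
      rcases hcases with h | ⟨h, h3, h4⟩ | ⟨h, -⟩
      · exact absurd h.2 (not_le.2 hlow)
      · rw [← h] at h3
        linarith
      · rw [mem_below, h] at hat
        exact absurd hat (not_lt.2 hmid)
    -- The partner is a machine at or above the middle load; there are more of these than machines
    -- to avoid. Keeping it out of all of `A` preserves disjointness when the set below `v` grows at
    -- earlier times.
    obtain ⟨b, hb, hbAP⟩ : ∃ b ∈ Finset.univ.filter (fun i =>
        lightLoadLoads τ G p t (midMachine (m := m) τ (lightLoadLoads τ G p t)) ≤
          lightLoadLoads τ G p t i), b ∉ (A \ below τ m G p v t) ∪ P := by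
      apply Finset.exists_mem_notMem_of_card_lt_card
      have h1 := card_midMachine_le τ (lightLoadLoads (m := m) τ G p t)
      have h2 := Finset.card_union_le (A \ below τ m G p v t) P
      rw [Finset.card_sdiff_of_subset hAt] at h2
      have h3 := NeZero.pos m
      omega
    simp only [Finset.mem_filter, Finset.mem_univ, true_and] at hb
    simp only [Finset.mem_union, Finset.mem_sdiff, mem_below, not_or, not_and, not_not] at hbAP
    have hbA : b ∉ A := fun h => absurd (hbAP.1 h) (not_lt.2 (hmid.trans hb))
    refine ⟨insert b P, Finset.disjoint_insert_left.2 ⟨hbA, hPA⟩, ?_, ?_⟩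
    · rw [Finset.card_insert_of_notMem hbAP.2, hcard, hPc]
    · rw [hcard, heq, Finset.sum_insert hat', Finset.sum_insert hbAP.2]
      have := lightLoadLoads_mono (m := m) τ G hp htT.le b
      push_cast
      linarith

/-- The situation in which a job is put on a least loaded machine and raises its load above
`1.75 B`, for `B` an upper bound on the optimum and on the guess `G`. -/
structure Critical (m : ℕ) [NeZero m] (G B : ℝ) (p : Fin n → ℝ) (T : Fin n) : Prop where
  nonneg : ∀ i, 0 ≤ p i
  sum_le : ∑ i, p i ≤ m * G
  le_bound : G ≤ B
  low_gt : 0.75 * B < lightLoadLoads τ G p T (lowMachine (m := m) τ (lightLoadLoads τ G p T))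
  size_gt : 0.75 * B < p T

namespace Critical

variable {τ} {B : ℝ} {T : Fin n}

lemma guess_nonneg (h : Critical τ m G B p T) : 0 ≤ G := by
  have hm : (0 : ℝ) < m := by exact_mod_cast NeZero.pos m
  exact nonneg_of_mul_nonneg_right ((Finset.sum_nonneg fun i _ => h.nonneg i).trans h.sum_le) hm

lemma low_add_mid_lt (h : Critical τ m G B p T) :
    lightLoadLoads τ G p T (lowMachine (m := m) τ (lightLoadLoads τ G p T)) +
      lightLoadLoads τ G p T (midMachine (m := m) τ (lightLoadLoads τ G p T)) < 2 * G := by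
  have hm : (0 : ℝ) < m := by exact_mod_cast NeZero.pos m
  have h1 := mul_low_add_mid_le τ (lightLoadLoads (m := m) τ G p T)
  have h2 := sum_lightLoadLoads_add_le (m := m) τ G h.nonneg T
  have h3 := h.sum_le
  have h4 := h.size_gt
  have h5 := h.guess_nonneg
  have h6 := h.le_bound
  refine lt_of_mul_lt_mul_left ?_ hm.le
  linarith

/-- The set below `v` and its partners have average load at least `G`, and at most three machines
remain, each missing at most `0.25 G`. Job `T`, not yet counted, exceeds this total deficit of at
most `0.75 G`, so the sum of sizes would exceed `m * G`. -/
lemma false_of_card_below_eq (h : Critical τ m G B p T) {t : ℕ} (ht : t ≤ T)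
    (hlow : 0.25 * G < lightLoadLoads τ G p t (lowMachine (m := m) τ (lightLoadLoads τ G p t)))
    (hcard : (below τ m G p
      (lightLoadLoads τ G p T (lowMachine (m := m) τ (lightLoadLoads τ G p T))) t).card + 1 =
        max 1 (m / 2)) : False := by
  have hlv := h.low_gt
  have hlm := lowMachine_le τ (lightLoadLoads (m := m) τ G p T)
  set v := lightLoadLoads τ G p T (lowMachine (m := m) τ (lightLoadLoads τ G p T))
  obtain ⟨P, hPA, hPc, hPs⟩ := exists_partners τ h.nonneg T.2.le hlm hcard.le ht
    (Finset.Subset.refl _) hlow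
  set A := below τ m G p v t
  have h1 := sum_lightLoadLoads_add_le (m := m) τ G h.nonneg T
  have hdisj : Disjoint A P := hPA.symm
  have h2 := Finset.sum_add_sum_compl (A ∪ P) (lightLoadLoads (m := m) τ G p T)
  rw [Finset.sum_union hdisj] at h2
  have h3 := Finset.card_nsmul_le_sum (A ∪ P)ᶜ (lightLoadLoads (m := m) τ G p T) v
    fun i _ => hlm i
  have hc := Finset.card_add_card_compl (A ∪ P)
  rw [Finset.card_union_of_disjoint hdisj, hPc, Fintype.card_fin] at hc
  rw [nsmul_eq_mul] at h3
  have hr : (A ∪ P)ᶜ.card ≤ 3 := by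
    have := NeZero.pos m
    omega
  set r := (A ∪ P)ᶜ.card
  have hr' : (r : ℝ) ≤ 3 := by exact_mod_cast hr
  have hc' : (A.card : ℝ) + A.card + r = m := by exact_mod_cast hc
  have hs := h.sum_le
  have hx := h.size_gt
  have hG := h.guess_nonneg
  have hB := h.le_bound
  have hv : (r : ℝ) * (0.75 * G) ≤ r * v := by
    gcongr
    linarith
  have hrG : (r : ℝ) * G ≤ 3 * G := by gcongr
  have : (m : ℝ) * G = 2 * G * A.card + r * G := by rw [← hc']; ring
  linarith

/-- Going backwards from `T`, where no machine is below `v`, the count grows by at most one per job.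
It would have to hit the forbidden value before passing it. -/
lemma card_below_lt (h : Critical τ m G B p T) {t : ℕ} (ht : t ≤ T)
    (hlow : 0.25 * G < lightLoadLoads τ G p t (lowMachine (m := m) τ (lightLoadLoads τ G p t))) :
    (below τ m G p
      (lightLoadLoads τ G p T (lowMachine (m := m) τ (lightLoadLoads τ G p T))) t).card + 1 <
        max 1 (m / 2) := by
  induction ht using Nat.decreasingInduction with
  | self =>
    refine lt_of_le_of_ne ?_ fun he => h.false_of_card_below_eq le_rfl hlow he
    have hempty : below τ m G p
        (lightLoadLoads τ G p T (lowMachine (m := m) τ (lightLoadLoads τ G p T))) T = ∅ := by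
      ext j; simp [mem_below, lowMachine_le]
    simp [hempty]
  | of_succ t ht ih =>
    have hmono := fun j => lightLoadLoads_mono (m := m) τ G h.nonneg (Nat.le_succ t) j
    have h1 := ih (hlow.trans_le (lowMachine_mono τ hmono))
    have h2 := (Finset.card_le_card (below_subset_insert τ (m := m) (G := G) (p := p)
      (lightLoadLoads τ G p T (lowMachine (m := m) τ (lightLoadLoads τ G p T)))
      ⟨t, ht.trans T.2⟩)).trans (Finset.card_insert_le _ _)
    have h3 : _ ≠ _ := h.false_of_card_below_eq ht.le hlow
    simp only at h2
    omega

/-- A machine that has received only jobs of size at most `B / 2` is lightly loaded. -/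
lemma load_le_of_small (h : Critical τ m G B p T) {j : Fin m}
    (hj : ∀ i < T, lightLoad τ m G p i = j → p i ≤ B / 2) {t : ℕ} (ht : t ≤ T) :
    lightLoadLoads τ G p t j ≤ 0.25 * G + 0.5 * B := by
  have hG := h.guess_nonneg
  have hB := h.le_bound
  induction t with
  | zero => simp only [lightLoadLoads]; linarith
  | succ t ih =>
    have htn : t < n := by omega
    have hs := lightLoadLoads_succ_apply τ G p ⟨t, htn⟩ j
    rw [show lightLoadLoads τ G p (t + 1) j = _ from hs]
    have ih' := ih (by omega)
    split_ifs with ha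
    · have hpt := hj ⟨t, htn⟩ (Fin.lt_def.2 ht) ha
      rcases lightLoad_cases τ (m := m) (G := G) (p := p) ⟨t, htn⟩ with
        ⟨h1, h2⟩ | ⟨-, -, h3⟩ | ⟨h1, h2⟩
      · rw [← h1, ha] at h2
        linarith
      -- The middle load is less than `2 G - 0.75 B` even at time `T`, so a job of size at most `B /
      -- 2` fits under `1.75 G` and this case cannot occur.
      · have hmono := midMachine_mono τ fun j =>
          lightLoadLoads_mono (m := m) τ G h.nonneg (show t ≤ T by omega) j
        have := h.low_add_mid_lt
        have := h.low_gt
        simp only at h3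
        linarith
      -- The middle machine is already at `v` or higher, whereas `j` is still below `v`.
      · have h3 := h.card_below_lt (show t ≤ T by omega) h2
        have h4 : lightLoadLoads τ G p t (midMachine (m := m) τ (lightLoadLoads τ G p t)) <
            lightLoadLoads τ G p T (lowMachine (m := m) τ (lightLoadLoads τ G p T)) := by
          rw [ha] at h1
          simp only at h1
          rw [← h1]
          have := h.low_gt
          linarith
        have := le_card_below τ h4
        omega
    · simpa using ih'

lemma bound_lt_opt (h : Critical τ m G B p T) : B < opt m p := by
  by_contra! hopt
  have hG := h.guess_nonneg
  have hB := h.le_bound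
  have hbig : ∀ j : Fin m, ∃ i < T, lightLoad τ m G p i = j ∧ B / 2 < p i := by
    intro j
    by_contra! hj
    have h1 := h.load_le_of_small hj le_rfl
    have h2 := lowMachine_le τ (lightLoadLoads (m := m) τ G p T) j
    have h3 := h.low_gt
    linarith
  choose g hgT hgj hgp using hbig
  have hinj : Function.Injective g := fun i j hij => by rw [← hgj i, ← hgj j, hij]
  have hT : T ∉ Finset.univ.image g := by
    simp only [Finset.mem_image, Finset.mem_univ, true_and, not_exists]
    exact fun j => (hgT j).ne
  have hcard : (insert T (Finset.univ.image g)).card = m + 1 := by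
    rw [Finset.card_insert_of_notMem hT, Finset.card_image_of_injective _ hinj]
    simp
  have hsub : insert T (Finset.univ.image g) ⊆ Finset.univ.filter fun i => opt m p < 2 * p i := by
    intro i hi
    simp only [Finset.mem_filter, Finset.mem_univ, true_and]
    rcases Finset.mem_insert.1 hi with rfl | hi
    · have := h.size_gt
      linarith
    · obtain ⟨j, -, rfl⟩ := Finset.mem_image.1 hi
      linarith [hgp j]
  have := (Finset.card_le_card hsub).trans (card_filter_opt_lt_le (m := m) h.nonneg)
  omega

end Critical

variable (G) in
/-- LightLoad is `1.75`-competitive if its guess is not less than the average load, up to the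
excess of the guess over the optimum. -/
theorem makespan_lightLoad_le_mul_max (hp : ∀ i, 0 ≤ p i) (hG : ∑ i, p i ≤ m * G) :
    makespan p (lightLoad τ m G p) ≤ 1.75 * max G (opt m p) := by
  have hopt := opt_nonneg (m := m) hp
  refine makespan_lightLoad_le τ G (by positivity) (fun T _ => ?_)
    (by gcongr; exact le_max_left _ _)
  by_contra! hgt
  have hm : (0 : ℝ) < m := by exact_mod_cast NeZero.pos m
  have hx : p T ≤ max G (opt m p) := (le_opt hp T).trans (le_max_right _ _)
  have hv : lightLoadLoads τ G p T (lowMachine (m := m) τ (lightLoadLoads τ G p T)) ≤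
      max G (opt m p) := by
    refine le_trans (le_of_mul_le_mul_left ?_ hm) (le_max_left _ _)
    have h1 := card_mul_lowMachine_le τ (lightLoadLoads (m := m) τ G p T)
    have h2 := sum_lightLoadLoads_add_le (m := m) τ G hp T
    linarith [hp T]
  -- Each of the two summands is at most `B`, so a sum above `1.75 B` forces both above `0.75 B`.
  have hcrit : Critical τ m G (max G (opt m p)) p T :=
    ⟨hp, hG, le_max_left _ _, by linarith, by linarith⟩
  exact absurd hcrit.bound_lt_opt (not_lt.2 (le_max_right _ _))

end Deterministic
/-! ### LightLoadROM is online and constant competitive -/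

section Guess

variable {m n : ℕ} {p : Fin n → ℝ}

lemma loadEstimate_nonneg (hp : ∀ i, 0 ≤ p i) : 0 ≤ loadEstimate m (1 / 4) p :=
  mul_nonneg (by positivity) (Finset.sum_nonneg fun i _ => hp i)

lemma loadEstimate_le (hp : ∀ i, 0 ≤ p i) : loadEstimate m (1 / 4) p ≤ 4 * ((∑ i, p i) / m) := by
  have h : ∑ t ∈ Finset.univ.filter (fun t : Fin n => ((t : ℕ) : ℝ) + 1 ≤ 1 / 4 * n), p t ≤
      ∑ i, p i :=
    Finset.sum_le_sum_of_subset_of_nonneg (Finset.filter_subset _ _) fun i _ _ => hp i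
  calc loadEstimate m (1 / 4) p ≤ 1 / (1 / 4 * (m : ℝ)) * ∑ i, p i := by
        unfold loadEstimate; gcongr
    _ = 4 * ((∑ i, p i) / m) := by field_simp

variable (τ : TieBreak) [NeZero m]

/-- The guesses may differ, because inputs that agree on a prefix need not yet agree on the
estimate. -/
lemma lightLoadLoads_congr {G G' : ℝ} {p q : Fin n → ℝ} {t : ℕ}
    (hpq : ∀ s : Fin n, (s : ℕ) < t → p s = q s)
    (hstep : ∀ s : Fin n, (s : ℕ) < t →
      lightLoadLoads (m := m) τ G p s = lightLoadLoads τ G' q s →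
        lightLoad τ m G p s = lightLoad τ m G' q s) :
    lightLoadLoads (m := m) τ G p t = lightLoadLoads τ G' q t := by
  induction t with
  | zero => rfl
  | succ t ih =>
    have ih' := ih (fun s hs => hpq s (by omega)) fun s hs => hstep s (by omega)
    by_cases ht : t < n
    · have h1 := lightLoadLoads_succ (m := m) τ G p ⟨t, ht⟩
      have h2 := lightLoadLoads_succ (m := m) τ G' q ⟨t, ht⟩
      rw [hstep ⟨t, ht⟩ (Nat.lt_succ_self t) ih', hpq ⟨t, ht⟩ (Nat.lt_succ_self t)] at h1
      simp only at h1 h2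
      rw [h1, h2, ih']
    · rw [lightLoadLoads_succ_of_le τ G p (not_lt.1 ht),
        lightLoadLoads_succ_of_le τ G' q (not_lt.1 ht), ih']

/-! ### Signs of `1 - margin m` for small `m` -/

lemma margin_nonneg (m : ℕ) : 0 ≤ margin m := by
  unfold margin
  exact div_nonneg zero_le_one (Real.log_natCast_nonneg m)

lemma one_lt_log_three : 1 < Real.log 3 := by
  rw [Real.lt_log_iff_exp_lt (by norm_num)]
  linarith [Real.exp_one_lt_d9]

lemma one_sub_margin_le {m : ℕ} (hm : 3 ≤ m) : 1 - 1 / Real.log 3 ≤ 1 - margin m := by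
  unfold margin
  have := one_lt_log_three
  gcongr
  exact_mod_cast hm

lemma one_sub_inv_log_three_pos : 0 < 1 - 1 / Real.log 3 := by
  have := one_lt_log_three
  rw [sub_pos, div_lt_one (by linarith)]
  exact this

/-- Since `log 2 < 1`, two machines are the exceptional case, where the guess is never positive. -/
lemma one_sub_margin_two_neg : 1 - margin 2 < 0 := by
  unfold margin
  have h2 := Real.log_two_lt_d9
  have h3 : 0 < Real.log 2 := Real.log_pos (by norm_num)
  rw [sub_neg, lt_div_iff₀ (by exact_mod_cast h3)]
  push_cast
  linarith

/-- `Real.log 1 = 0` and division by zero yield the convention `δ = 0`. -/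
lemma margin_one : margin 1 = 0 := by simp [margin]

lemma one_sub_margin_ne_zero (hm : 1 ≤ m) : 1 - margin m ≠ 0 := by
  obtain rfl | rfl | h : m = 1 ∨ m = 2 ∨ 3 ≤ m := by omega
  · simp [margin_one]
  · exact one_sub_margin_two_neg.ne
  · exact (one_sub_inv_log_three_pos.trans_le (one_sub_margin_le h)).ne'

lemma average_le_opt : (∑ i, p i) / m ≤ opt m p := by
  have hm : (0 : ℝ) < m := by exact_mod_cast NeZero.pos m
  rw [div_le_iff₀' hm]
  exact sum_le_mul_opt p

lemma guessPre_le_mul_opt (hp : ∀ i, 0 ≤ p i) :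
    guessPre m p ≤ 4 / (1 - 1 / Real.log 3) * opt m p := by
  have h0 := loadEstimate_nonneg (m := m) hp
  have h1 : loadEstimate m (1 / 4) p ≤ 4 * opt m p :=
    (loadEstimate_le hp).trans (by gcongr; exact average_le_opt)
  have hc := one_sub_inv_log_three_pos
  have hopt := opt_nonneg (m := m) hp
  rw [div_mul_eq_mul_div]
  unfold guessPre
  have hpos := NeZero.pos m
  rcases lt_or_ge (1 - margin m) 0 with h | h
  · exact (div_nonpos_of_nonneg_of_nonpos h0 h.le).trans (by positivity)
  · have hge : 1 - 1 / Real.log 3 ≤ 1 - margin m := by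
      obtain h' | rfl | h' : m = 1 ∨ m = 2 ∨ 3 ≤ m := by omega
      · have := one_lt_log_three
        have : (0 : ℝ) ≤ 1 / Real.log 3 := by positivity
        rw [h', margin_one]
        linarith
      · exact absurd h (not_le.2 one_sub_margin_two_neg)
      · exact one_sub_margin_le h'
    gcongr

theorem lightLoadROM_constantCompetitive : (lightLoadROM τ).ConstantCompetitive := by
  have hc := one_sub_inv_log_three_pos
  have h4 : 4 ≤ 4 / (1 - 1 / Real.log 3) := by
    have := one_lt_log_three
    rw [le_div_iff₀ hc]
    have : (0 : ℝ) ≤ 1 / Real.log 3 := by positivity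
    linarith
  refine ⟨1.75 * (4 / (1 - 1 / Real.log 3)), by linarith, fun m _ n p hp σ => ?_⟩
  have hpσ : ∀ i, 0 ≤ (p ∘ σ) i := fun i => hp _
  rw [← opt_comp_perm p σ]
  have hopt := opt_nonneg (m := m) hpσ
  refine makespan_lightLoad_le_of_average τ _ hpσ (by positivity) (fun t => ?_) ?_
  · have h1 := average_le_opt (m := m) (p := p ∘ σ)
    have h2 := le_opt (m := m) hpσ t
    nlinarith
  · have := guessPre_le_mul_opt (m := m) hpσ
    linarith

/-- While the load estimate is being determined, LightLoadROM uses a least loaded machine. -/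
lemma lightLoad_guessPre_eq_low (hp : ∀ i, 0 ≤ p i) {t : Fin n}
    (ht : ((t : ℕ) : ℝ) + 1 ≤ 1 / 4 * n) :
    lightLoad τ m (guessPre m p) p t =
      lowMachine τ (lightLoadLoads τ (guessPre m p) p t) := by
  have hm : (0 : ℝ) < m := by exact_mod_cast NeZero.pos m
  unfold lightLoad lightLoadStep
  refine if_pos ?_
  -- A negative guess, possible for `m = 2`, triggers the second condition of the algorithm; a
  -- nonnegative one triggers the first, as the average load so far is at most a quarter of the
  -- estimate.
  rcases lt_or_ge (guessPre m p) 0 with hG | hG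
  · right
    have := lightLoadLoads_nonneg (m := m) τ (guessPre m p) hp t
      (midMachine τ (lightLoadLoads τ (guessPre m p) p t))
    have := hp t
    linarith
  · left
    have h1 := card_mul_lowMachine_le τ (lightLoadLoads (m := m) τ (guessPre m p) p t)
    rw [sum_lightLoadLoads] at h1
    have h2 : ∑ i ∈ Finset.univ.filter (fun i : Fin n => (i : ℕ) < (t : ℕ)), p i ≤
        ∑ i ∈ Finset.univ.filter (fun i : Fin n => ((i : ℕ) : ℝ) + 1 ≤ 1 / 4 * n), p i := by
      refine Finset.sum_le_sum_of_subset_of_nonneg (fun i hi => ?_) fun i _ _ => hp i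
      simp only [Finset.mem_filter, Finset.mem_univ, true_and] at hi ⊢
      have : ((i : ℕ) : ℝ) ≤ (t : ℕ) := by exact_mod_cast hi.le
      linarith
    have h3 : ∑ i ∈ Finset.univ.filter (fun i : Fin n => ((i : ℕ) : ℝ) + 1 ≤ 1 / 4 * n), p i =
        m * (0.25 * loadEstimate m (1 / 4) p) := by
      unfold loadEstimate
      generalize ∑ i ∈ Finset.univ.filter (fun i : Fin n => ((i : ℕ) : ℝ) + 1 ≤ 1 / 4 * n), p i = z
      field_simp
      ring
    have h4 : loadEstimate m (1 / 4) p = guessPre m p * (1 - margin m) := by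
      unfold guessPre
      rw [div_mul_cancel₀ _ (one_sub_margin_ne_zero (NeZero.pos m))]
    have h5 : loadEstimate m (1 / 4) p ≤ guessPre m p := by
      rw [h4]
      have := mul_nonneg hG (margin_nonneg m)
      linarith
    have h6 := le_of_mul_le_mul_left ((h1.trans h2).trans h3.le) hm
    linarith

theorem lightLoadROM_isOnline : (lightLoadROM τ).IsOnline := by
  intro m _ n p q hp hq t hpq
  have hpq' : ∀ s : Fin n, (s : ℕ) < t → p s = q s := fun s hs => hpq s (Fin.lt_def.2 hs).le
  change lightLoad τ m (guessPre m p) p t = lightLoad τ m (guessPre m q) q t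
  by_cases ht : ((t : ℕ) : ℝ) + 1 ≤ 1 / 4 * n
  · rw [lightLoad_guessPre_eq_low τ hp ht, lightLoad_guessPre_eq_low τ hq ht,
      lightLoadLoads_congr τ hpq']
    intro s hs hl
    have hs' : ((s : ℕ) : ℝ) + 1 ≤ 1 / 4 * n := by
      have : ((s : ℕ) : ℝ) ≤ (t : ℕ) := by exact_mod_cast hs.le
      linarith
    rw [lightLoad_guessPre_eq_low τ hp hs', lightLoad_guessPre_eq_low τ hq hs', hl]
  -- The sampling phase is over, so the estimate uses only jobs that arrived strictly before `t`.
  · have hG : guessPre m p = guessPre m q := by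
      unfold guessPre loadEstimate
      congr 2
      refine Finset.sum_congr rfl fun s hs => hpq' s ?_
      simp only [Finset.mem_filter, Finset.mem_univ, true_and] at hs
      have : ((s : ℕ) : ℝ) < (t : ℕ) := by linarith
      exact_mod_cast this
    have hl : lightLoadLoads (m := m) τ (guessPre m p) p t =
        lightLoadLoads τ (guessPre m q) q t := by
      refine lightLoadLoads_congr τ hpq' fun s hs hl => ?_
      rw [hG] at hl ⊢
      unfold lightLoad
      rw [hl, hpq' s hs]
    unfold lightLoad
    rw [hl, hG, hpq t le_rfl]

end Guess
/-! ### Sampling without replacement -/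

section Sampling

variable {n : ℕ}

lemma sum_perm_mul_swap (F : Equiv.Perm (Fin n) → ℝ) (s t : Fin n) :
    ∑ σ : Equiv.Perm (Fin n), F (σ * Equiv.swap s t) = ∑ σ : Equiv.Perm (Fin n), F σ :=
  Equiv.sum_comp (Equiv.mulRight (Equiv.swap s t)) F

lemma mul_sum_perm_apply (g : Fin n → ℝ) (s : Fin n) :
    n * ∑ σ : Equiv.Perm (Fin n), g (σ s) = n.factorial * ∑ i, g i := by
  have h1 : ∀ t, ∑ σ : Equiv.Perm (Fin n), g (σ t) = ∑ σ : Equiv.Perm (Fin n), g (σ s) := by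
    intro t
    rw [← sum_perm_mul_swap (fun σ => g (σ s)) s t]
    simp
  have h2 : ∑ t, ∑ σ : Equiv.Perm (Fin n), g (σ t) = n.factorial * ∑ i, g i := by
    rw [Finset.sum_comm]
    simp only [Equiv.sum_comp]
    simp [Fintype.card_perm]
  simpa [h1] using h2

/-- By symmetry the sum is the same for every position `t ≠ s`. Over all positions the sums total
zero, and the diagonal one is nonnegative. -/
lemma sum_perm_mul_nonpos {q : Fin n → ℝ} (hq : ∑ i, q i = 0) {s t : Fin n} (hst : s ≠ t) :
    ∑ σ : Equiv.Perm (Fin n), q (σ s) * q (σ t) ≤ 0 := by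
  by_contra! hpos
  have h1 : ∀ u, u ≠ s → ∑ σ : Equiv.Perm (Fin n), q (σ s) * q (σ u) =
      ∑ σ : Equiv.Perm (Fin n), q (σ s) * q (σ t) := by
    intro u hu
    rw [← sum_perm_mul_swap (fun σ => q (σ s) * q (σ t)) t u]
    simp [Equiv.swap_apply_of_ne_of_ne hst hu.symm]
  have h2 : ∑ u, ∑ σ : Equiv.Perm (Fin n), q (σ s) * q (σ u) = 0 := by
    rw [Finset.sum_comm]
    refine Finset.sum_eq_zero fun σ _ => ?_
    rw [← Finset.mul_sum, Equiv.sum_comp σ q, hq, mul_zero]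
  refine absurd h2 (Finset.sum_pos' (fun u _ => ?_) ⟨t, Finset.mem_univ _, hpos⟩).ne'
  by_cases hu : u = s
  · subst hu
    exact Finset.sum_nonneg fun σ _ => mul_self_nonneg _
  · rw [h1 u hu]
    exact hpos.le

/-- The second moment of the sum of a sample drawn without replacement from a centered
population. -/
lemma mul_sum_perm_sq_le {q : Fin n → ℝ} (hq : ∑ i, q i = 0) (S : Finset (Fin n)) :
    n * ∑ σ : Equiv.Perm (Fin n), (∑ s ∈ S, q (σ s)) ^ 2 ≤
      S.card * (n.factorial * ∑ i, q i ^ 2) := by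
  have h1 : ∑ σ : Equiv.Perm (Fin n), (∑ s ∈ S, q (σ s)) ^ 2 ≤
      ∑ s ∈ S, ∑ σ : Equiv.Perm (Fin n), q (σ s) ^ 2 := by
    simp only [sq, Finset.sum_mul_sum]
    rw [Finset.sum_comm]
    refine Finset.sum_le_sum fun s hs => ?_
    rw [Finset.sum_comm, ← Finset.add_sum_erase S _ hs]
    have := Finset.sum_nonpos (s := S.erase s)
      (f := fun t => ∑ σ : Equiv.Perm (Fin n), q (σ s) * q (σ t))
      fun t ht => sum_perm_mul_nonpos hq (Finset.ne_of_mem_erase ht).symm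
    linarith
  calc (n : ℝ) * ∑ σ : Equiv.Perm (Fin n), (∑ s ∈ S, q (σ s)) ^ 2
      ≤ n * ∑ s ∈ S, ∑ σ : Equiv.Perm (Fin n), q (σ s) ^ 2 := by gcongr
    _ = S.card * (n.factorial * ∑ i, q i ^ 2) := by
        rw [Finset.mul_sum]
        simp only [mul_sum_perm_apply (fun i => q i ^ 2)]
        simp

lemma orderProb_mono {E F : Equiv.Perm (Fin n) → Prop} (h : ∀ σ, E σ → F σ) :
    orderProb E ≤ orderProb F := by
  classical
  unfold orderProb
  gcongr with σ
  exact h σ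

lemma orderProb_eq_zero {E : Equiv.Perm (Fin n) → Prop} (h : ∀ σ, ¬ E σ) : orderProb E = 0 := by
  simp [orderProb, h]

lemma orderProb_mul_sq_le (X : Equiv.Perm (Fin n) → ℝ) {η : ℝ} (hη : 0 ≤ η) :
    orderProb (fun σ => η ≤ |X σ|) * η ^ 2 * n.factorial ≤ ∑ σ, X σ ^ 2 := by
  classical
  have hn : (n.factorial : ℝ) ≠ 0 := by positivity
  have h1 : ∑ σ ∈ Finset.univ.filter (fun σ => η ≤ |X σ|), η ^ 2 ≤ ∑ σ, X σ ^ 2 := by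
    refine (Finset.sum_le_sum fun σ hσ => ?_).trans
      (Finset.sum_le_sum_of_subset_of_nonneg (Finset.filter_subset _ _) fun σ _ _ => sq_nonneg _)
    rw [← sq_abs (X σ)]
    have : η ≤ |X σ| := (Finset.mem_filter.1 hσ).2
    gcongr
  rw [Finset.sum_const, nsmul_eq_mul] at h1
  unfold orderProb
  convert h1 using 1
  field_simp

/-- Chebyshev's inequality for sampling without replacement. -/
lemma orderProb_deviation_le {p : Fin n → ℝ} (hp : ∀ i, 0 ≤ p i) {M : ℝ} (hM : ∀ i, p i ≤ M)
    (hn : 0 < n) (S : Finset (Fin n)) {η : ℝ} (hη : 0 ≤ η) :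
    orderProb (fun σ : Equiv.Perm (Fin n) =>
      η ≤ |∑ s ∈ S, p (σ s) - S.card / n * ∑ i, p i|) * η ^ 2 * n ≤
        S.card * (M * ∑ i, p i) := by
  have hn' : (0 : ℝ) < n := by exact_mod_cast hn
  set W := ∑ i, p i with hW
  have hq : ∑ i, (p i - W / n) = 0 := by
    rw [Finset.sum_sub_distrib, Finset.sum_const, Finset.card_univ, Fintype.card_fin,
      nsmul_eq_mul, mul_div_cancel₀ _ hn'.ne', ← hW, sub_self]
  -- Centering only decreases the second moment, and `∑ p i ^ 2 ≤ M * W`.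
  have hq2 : ∑ i, (p i - W / n) ^ 2 ≤ M * W := by
    have h1 : ∑ i, (p i - W / n) ^ 2 = ∑ i, (p i * p i - W / n * (p i - W / n) - W / n * p i) :=
      Finset.sum_congr rfl fun i _ => by ring
    rw [h1, Finset.sum_sub_distrib, Finset.sum_sub_distrib, ← Finset.mul_sum, ← Finset.mul_sum, hq,
      ← hW]
    have h2 : ∑ i, p i * p i ≤ M * W := by
      rw [hW, Finset.mul_sum]
      exact Finset.sum_le_sum fun i _ => mul_le_mul_of_nonneg_right (hM i) (hp i)
    have h3 : 0 ≤ W / n * W := by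
      rw [div_mul_eq_mul_div]
      exact div_nonneg (mul_self_nonneg _) hn'.le
    linarith
  have hX : ∀ σ : Equiv.Perm (Fin n),
      ∑ s ∈ S, p (σ s) - S.card / n * W = ∑ s ∈ S, (p (σ s) - W / n) := by
    intro σ
    rw [Finset.sum_sub_distrib, Finset.sum_const, nsmul_eq_mul]
    ring
  have hfac : (0 : ℝ) < n.factorial := by positivity
  have h1 := orderProb_mul_sq_le
    (fun σ : Equiv.Perm (Fin n) => ∑ s ∈ S, p (σ s) - S.card / n * W) hη
  have h2 := mul_sum_perm_sq_le hq S
  simp only [hX] at h1 ⊢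
  refine le_of_mul_le_mul_right ?_ hfac
  calc _ ≤ (n : ℝ) * ∑ σ : Equiv.Perm (Fin n), (∑ s ∈ S, (p (σ s) - W / n)) ^ 2 := by
        refine le_trans (le_of_eq ?_) (mul_le_mul_of_nonneg_left h1 hn'.le)
        ring
    _ ≤ _ := h2
    _ ≤ S.card * (n.factorial * (M * W)) := by gcongr
    _ = _ := by ring

end Sampling
/-! ### LightLoadROM in the random-order model -/

section RandomOrder

variable (τ : TieBreak) {m : ℕ} [NeZero m] {n : ℕ} {p : Fin n → ℝ}

lemma card_first_quarter (n : ℕ) :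
    (Finset.univ.filter (fun t : Fin n => ((t : ℕ) : ℝ) + 1 ≤ 1 / 4 * n)).card = n / 4 := by
  have h : ∀ t : Fin n, ((t : ℕ) : ℝ) + 1 ≤ 1 / 4 * n ↔ (t : ℕ) < n / 4 := by
    intro t
    have h1 : ((t : ℕ) : ℝ) + 1 ≤ 1 / 4 * n ↔ (((4 * ((t : ℕ) + 1) : ℕ)) : ℝ) ≤ (n : ℕ) := by
      push_cast
      constructor <;> intro h <;> linarith
    rw [h1, Nat.cast_le]
    omega
  simp only [h, Fin.card_filter_val_lt]
  exact min_eq_right (Nat.div_le_self _ _)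

/-- If the jobs are small compared to the optimum in sum, LightLoadROM is `1.75`-competitive in
every order. -/
lemma cost_le_of_average_le (hp : ∀ i, 0 ≤ p i) (hδ : margin m ≤ 1 / 5)
    (hL : 5 * ((∑ i, p i) / m) ≤ opt m p) : (lightLoadROM τ).cost m p ≤ 1.75 * opt m p := by
  have hopt := opt_nonneg (m := m) hp
  refine makespan_lightLoad_le_of_average τ _ hp (by positivity) (fun t => ?_) ?_
  · have := le_opt (m := m) hp t
    linarith
  -- The guess is at most `4 / (4 / 5) = 5` times the average load, hence at most the optimum.
  · gcongr
    unfold guessPre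
    rw [div_le_iff₀ (by linarith)]
    have h1 := loadEstimate_le (m := m) hp
    have h2 := mul_le_mul_of_nonneg_left (show 4 / 5 ≤ 1 - margin m by linarith) hopt
    linarith

/-- LightLoadROM performs well if the load estimate is accurate. -/
lemma cost_le_of_estimate (hp : ∀ i, 0 ≤ p i) (hδ : margin m < 1)
    (hlow : (1 - margin m) * ((∑ i, p i) / m) ≤ loadEstimate m (1 / 4) p)
    (hup : loadEstimate m (1 / 4) p ≤ (1 + margin m) * ((∑ i, p i) / m)) :
    (lightLoadROM τ).cost m p ≤ 1.75 * ((1 + margin m) / (1 - margin m) * opt m p) := by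
  have hm : (0 : ℝ) < m := by exact_mod_cast NeZero.pos m
  have h1 : 0 < 1 - margin m := by linarith
  have hopt := opt_nonneg (m := m) hp
  have hδ0 := margin_nonneg m
  refine (makespan_lightLoad_le_mul_max τ (guessPre m p) hp ?_).trans ?_
  · rw [← div_le_iff₀' hm]
    unfold guessPre
    rw [le_div_iff₀' h1]
    exact hlow
  · gcongr
    refine max_le ?_ ?_
    · unfold guessPre
      rw [div_mul_eq_mul_div]
      gcongr
      refine hup.trans ?_
      gcongr
      exact average_le_opt
    · refine le_mul_of_one_le_left hopt ?_
      rw [one_le_div h1]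
      linarith

/-- The load estimate is accurate with high probability. -/
lemma orderProb_estimate_le (hp : ∀ i, 0 ≤ p i) (hpos : 0 < ∑ i, p i)
    (hL : opt m p < 5 * ((∑ i, p i) / m)) (hδ : 0 < margin m) (hδm : 40 ≤ margin m * m) :
    orderProb (fun σ : Equiv.Perm (Fin n) =>
      ¬ ((1 - margin m) * ((∑ i, p i) / m) ≤ loadEstimate m (1 / 4) (p ∘ σ) ∧
        loadEstimate m (1 / 4) (p ∘ σ) ≤ (1 + margin m) * ((∑ i, p i) / m))) ≤
      80 / (margin m ^ 2 * m) := by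
  have hm : (0 : ℝ) < m := by exact_mod_cast NeZero.pos m
  set W := ∑ i, p i with hW
  set δ := margin m with hδdef
  set S := Finset.univ.filter (fun t : Fin n => ((t : ℕ) : ℝ) + 1 ≤ 1 / 4 * n) with hS
  have hn0 : 0 < n := by
    rcases Nat.eq_zero_or_pos n with rfl | h
    · simp [hW] at hpos
    · exact h
  have hn : (0 : ℝ) < n := by exact_mod_cast hn0
  -- All sizes are at most `OPT < 5 W / m`, so a total of `W` takes more than `m / 5` jobs.
  have hmn : (m : ℝ) < 5 * n := by
    have h1 : W ≤ n * opt m p := by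
      have := Finset.sum_le_card_nsmul Finset.univ p _ fun i _ => le_opt (m := m) hp i
      simpa using this
    have h2 : n * opt m p < n * (5 * (W / m)) := by gcongr
    have h3 : W * m < W * (5 * n) := by
      have h4 := h1.trans_lt h2
      rw [show (n : ℝ) * (5 * (W / m)) = W * (5 * n) / m by ring, lt_div_iff₀ hm] at h4
      exact h4
    exact lt_of_mul_lt_mul_left h3 hpos.le
  have hScard : S.card = n / 4 := card_first_quarter n
  have hSup : (S.card : ℝ) / n ≤ 1 / 4 := by
    have : 4 * S.card ≤ n := by omega
    have : 4 * (S.card : ℝ) ≤ n := by exact_mod_cast this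
    rw [div_le_iff₀ hn]
    linarith
  have hSlow : 1 / 4 - 1 / n ≤ (S.card : ℝ) / n := by
    have : n ≤ 4 * S.card + 4 := by omega
    have : (n : ℝ) ≤ 4 * S.card + 4 := by exact_mod_cast this
    rw [le_div_iff₀ hn, sub_mul, one_div_mul_cancel hn.ne']
    linarith
  -- The rounding of `n / 4` biases the sampled sum by at most `W / n ≤ δ W / 8`. With a sampling
  -- error below `δ W / 8` the total stays below `δ W / 4`, and the factor `4` in the estimate turns
  -- this into `δ W`.
  have hbias : 1 / (n : ℝ) ≤ δ / 8 := by
    rw [div_le_div_iff₀ hn (by norm_num)]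
    nlinarith
  have hprob := orderProb_deviation_le hp (le_opt (m := m) hp) hn0 S
    (show 0 ≤ δ * W / 8 by positivity)
  rw [← hW] at hprob
  refine (orderProb_mono (F := fun σ : Equiv.Perm (Fin n) =>
    δ * W / 8 ≤ |∑ s ∈ S, p (σ s) - S.card / n * W|) fun σ hσ => ?_).trans ?_
  · by_contra! hlt
    refine hσ ?_
    have hest : loadEstimate m (1 / 4) (p ∘ σ) = 4 * (∑ s ∈ S, p (σ s)) / m := by
      unfold loadEstimate
      simp only [Function.comp_apply, ← hS]
      generalize ∑ s ∈ S, p (σ s) = z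
      field_simp
    obtain ⟨h1, h2⟩ := abs_lt.1 hlt
    have h3 := mul_le_mul_of_nonneg_right hSup hpos.le
    have h4 := mul_le_mul_of_nonneg_right hSlow hpos.le
    have h5 := mul_le_mul_of_nonneg_right hbias hpos.le
    rw [hest, ← mul_div_assoc, ← mul_div_assoc]
    constructor <;> refine div_le_div_of_nonneg_right ?_ hm.le <;> linarith
  · set P := orderProb (fun σ : Equiv.Perm (Fin n) =>
      δ * W / 8 ≤ |∑ s ∈ S, p (σ s) - S.card / n * W|)
    have hbound : (S.card : ℝ) * (opt m p * W) ≤ n / 4 * (5 * (W / m) * W) := by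
      rw [div_le_iff₀ hn] at hSup
      have hopt := opt_nonneg (m := m) hp
      gcongr
      linarith
    have h1 := hprob.trans hbound
    rw [le_div_iff₀ (by positivity)]
    -- The constant is `80 = 64 * 5 / 4`, from the squared threshold, `OPT < 5 W / m` and the
    -- sampled quarter.
    have h2 : P * (δ ^ 2 * m) * (n * W ^ 2 / (64 * m)) ≤ 80 * (n * W ^ 2 / (64 * m)) := by
      calc _ = P * (δ * W / 8) ^ 2 * n := by field_simp; norm_num
        _ ≤ _ := h1
        _ = _ := by field_simp; norm_num
    exact le_of_mul_le_mul_right h2 (by positivity)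

lemma eventually_margin {ε : ℝ} (hε : 0 < ε) : ∀ᶠ m : ℕ in Filter.atTop,
    0 < margin m ∧ margin m ≤ 1 / 5 ∧ margin m ≤ ε / 10 ∧ 40 ≤ margin m * m ∧
      80 / (margin m ^ 2 * m) ≤ ε := by
  have hlog : Filter.Tendsto (fun m : ℕ => Real.log m) Filter.atTop Filter.atTop :=
    Real.tendsto_log_atTop.comp tendsto_natCast_atTop_atTop
  have h1 := (Real.isLittleO_pow_log_id_atTop (n := 1)).def (c := 1 / 40) (by norm_num)
  have h2 := (Real.isLittleO_pow_log_id_atTop (n := 2)).def (c := ε / 80) (by positivity)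
  filter_upwards [hlog.eventually_ge_atTop 5, hlog.eventually_ge_atTop (10 / ε),
    tendsto_natCast_atTop_atTop.eventually h1, tendsto_natCast_atTop_atTop.eventually h2,
    Filter.eventually_ge_atTop 1] with m h5 hε10 h1 h2 hm
  have hm' : (0 : ℝ) < m := by exact_mod_cast hm
  have hl : 0 < Real.log m := by linarith
  simp only [pow_one, id, Real.norm_eq_abs, abs_of_pos hl, abs_of_pos hm',
    abs_of_pos (pow_pos hl 2)] at h1 h2
  unfold margin
  refine ⟨by positivity, ?_, ?_, ?_, ?_⟩
  · gcongr
  · rw [div_le_div_iff₀ hl (by norm_num)]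
    rw [div_le_iff₀ hε] at hε10
    linarith
  · rw [div_mul_eq_mul_div, le_div_iff₀ hl]
    linarith
  · rw [div_pow, one_pow, div_mul_eq_mul_div, one_mul, div_div_eq_mul_div, div_le_iff₀ hm']
    linarith

theorem lightLoadROM_nearlyCompetitive : (lightLoadROM τ).NearlyCompetitive 1.75 := by
  refine ⟨lightLoadROM_constantCompetitive τ, fun ε hε => ?_⟩
  obtain ⟨m₀, hm₀⟩ := Filter.eventually_atTop.1 (eventually_margin hε)
  refine ⟨m₀, fun m _ hm n p hp ⟨i₀, hi₀⟩ => ?_⟩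
  obtain ⟨hδ, hδ5, hδε, hδm, hprob⟩ := hm₀ m hm
  have hopt : 0 < opt m p := hi₀.trans_le (le_opt hp i₀)
  have hpσ : ∀ σ : Equiv.Perm (Fin n), ∀ i, 0 ≤ (p ∘ σ) i := fun σ i => hp _
  have hsum : ∀ σ : Equiv.Perm (Fin n), ∑ i, (p ∘ σ) i = ∑ i, p i := fun σ => Equiv.sum_comp σ p
  rcases le_or_gt (5 * ((∑ i, p i) / m)) (opt m p) with hL | hL
  · rw [orderProb_eq_zero]
    · exact hε.le
    · intro σ hσ
      have := cost_le_of_average_le τ (m := m) (hpσ σ) hδ5 (by rwa [hsum, opt_comp_perm])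
      rw [opt_comp_perm] at this
      have := mul_pos hε hopt
      linarith
  · refine (orderProb_mono fun σ hσ => ?_).trans ((orderProb_estimate_le hp
      (Finset.sum_pos' (fun i _ => hp i) ⟨i₀, Finset.mem_univ _, hi₀⟩) hL hδ hδm).trans hprob)
    rintro ⟨hlow, hup⟩
    have h1 := cost_le_of_estimate τ (m := m) (hpσ σ) (by linarith) (by rwa [hsum]) (by rwa [hsum])
    rw [opt_comp_perm, ← mul_assoc] at h1
    -- This amounts to `3.5 δ + ε δ < ε`, and `δ ≤ ε / 10`, `δ ≤ 1 / 5` bound the left side by `0.55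
    -- ε`.
    have h2 : 1.75 * ((1 + margin m) / (1 - margin m)) < 1.75 + ε := by
      rw [← mul_div_assoc, div_lt_iff₀ (by linarith)]
      nlinarith
    have h3 := mul_lt_mul_of_pos_right h2 hopt
    linarith

/-- Nearly `c`-competitive algorithms are `c`-competitive in the secretary model. -/
theorem Algorithm.NearlyCompetitive.secretaryCompetitive {A : Algorithm} {c : ℝ} (hc : 0 ≤ c)
    (h : A.NearlyCompetitive c) : A.SecretaryCompetitive c := by
  classical
  obtain ⟨⟨C, hC, hcost⟩, hnear⟩ := h
  intro ε hε
  obtain ⟨m₀, hm₀⟩ := hnear (ε / (1 + C)) (by positivity)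
  -- Typical orders cost at most `(c + η) OPT` and the exceptional ones add at most `η C OPT` in
  -- expectation; `η (1 + C) = ε` balances the two.
  set η := ε / (1 + C) with hη
  have hηε : η * (1 + C) = ε := div_mul_cancel₀ _ (by positivity)
  have hη0 : 0 < η := by positivity
  refine ⟨m₀, fun m _ hm n p hp => ?_⟩
  have hopt := opt_nonneg (m := m) hp
  have hfac : (0 : ℝ) < n.factorial := by positivity
  unfold Algorithm.romCost
  rw [one_div_mul_eq_div, div_le_iff₀ hfac]
  by_cases hpos : ∃ i, 0 < p i
  · have hp1 := hm₀ m hm n p hp hpos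
    unfold orderProb at hp1
    rw [div_le_iff₀ hfac] at hp1
    have hsum : ∑ σ : Equiv.Perm (Fin n), A.cost m (p ∘ σ) ≤
        ∑ σ : Equiv.Perm (Fin n), ((c + η) * opt m p +
          if A.cost m (p ∘ σ) ≥ (c + η) * opt m p then C * opt m p else 0) := by
      refine Finset.sum_le_sum fun σ _ => ?_
      have h1 := hcost m n p hp σ
      have h2 : 0 ≤ (c + η) * opt m p := by positivity
      split_ifs with h
      · linarith
      · push Not at h
        linarith
    rw [Finset.sum_add_distrib, ← Finset.sum_filter] at hsum
    simp only [Finset.sum_const, Finset.card_univ, Fintype.card_perm, Fintype.card_fin,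
      nsmul_eq_mul] at hsum
    have hp2 := mul_le_mul_of_nonneg_right hp1 (show 0 ≤ C * opt m p by positivity)
    refine (hsum.trans (add_le_add_right (le_of_eq_of_le ?_ hp2) _)).trans (le_of_eq ?_)
    · congr!
    · rw [← hηε]
      ring
  · push Not at hpos
    have hopt0 : opt m p ≤ 0 := by
      obtain rfl : p = 0 := funext fun i => le_antisymm (hpos i) (hp i)
      exact (ciInf_le (Set.finite_range _).bddBelow fun _ => 0).trans (makespan_le (by simp))
    have hopt0 := le_antisymm hopt0 hopt
    rw [hopt0]
    refine le_of_le_of_eq (Finset.sum_nonpos fun σ _ => ?_) (by simp)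
    have := hcost m n p hp σ
    rwa [hopt0, mul_zero] at this

end RandomOrder

end Scheduling

end

theorem mainTheorem2 (τ : Scheduling.TieBreak) :
    (Scheduling.lightLoadROM τ).IsOnline ∧
      (Scheduling.lightLoadROM τ).NearlyCompetitive 1.75 ∧
        (Scheduling.lightLoadROM τ).SecretaryCompetitive 1.75 :=
  ⟨Scheduling.lightLoadROM_isOnline τ, Scheduling.lightLoadROM_nearlyCompetitive τ,
    (Scheduling.lightLoadROM_nearlyCompetitive τ).secretaryCompetitive (by norm_num)⟩
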